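/- Consider a Bayesian budgeted multi-armed bandit with $K\ge 1$ independent arms, a budget $B\in\mathbb{N}_0$ and deterministic costs $c_a\in\{1,2,\dots\}$, $a\in\{1,\dots,K\}$. Each arm $a$ has an unknown parameter $\theta_a$ drawn from its prior $\mathcal{P}_a(y_{a,0})$, where $y_{a,0}$ is the initial belief; given $\theta_a$, the rewards $R_{a,1},R_{a,2},\dots$ of the successive pulls of arm $a$ are i.i.d. nonnegative random variables with distribution $\mathcal{R}_a(\theta_a)$. Assume $\mathbb{E}[R_{a,1}]<\infty$ for every $a$. Put $\mu_a(\theta_a)=\mathbb{E}[R_{a,1}\mid\theta_a]$ and $\hat\mu_{a,n}=\mathbb{E}[\mu_a(\theta_a)\mid R_{a,1},\dots,R_{a,n}]$ for $n\ge 0$. A policy $\pi$ chooses the arm $A_t$ played at time $t=1,2,\dots$ as a (measurable) function of $(A_s,r_s)_{s<t}$ and possibly of a random seed that is independent of all parameters and rewards; here $r_t=R_{A_t,n_t}$ with $n_t=\#\{s\le t: A_s=A_t\}$. Let $\tau=\min\{t:\sum_{s=1}^t c_{A_s}>B\}$, $V(\pi)=\mathbb{E}\big[\sum_{t=1}^{\tau-1}r_t\big]$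 and $V^\star=\sup_\pi V(\pi)$. With $m_a=\max\{\lfloor B/c_a\rfloor-1,0\}$, define $$W^{\mathrm{BTS}}=\mathbb{E}\Big[B\max_{a}\frac{\mu_a(\theta_a)}{c_a}\Big],\qquad W^{\mathrm{IRS.FH}}=\mathbb{E}\Big[B\max_{a}\frac{\hat\mu_{a,m_a}}{c_a}\Big],\qquad W^{\mathrm{IRS.V\text{-}Zero}}=\mathbb{E}\Big[\max_{n}\sum_{a=1}^K\sum_{i=1}^{n_a}\hat\mu_{a,i-1}\Big],$$ where the last maximum is over all $n=(n_1,\dots,n_K)\in\mathbb{N}_0^K$ with $\sum_{a=1}^K c_a n_a\le B$. Theorem 1 (Monotonicity of performance bounds). All these expectations and the supremum $V^\star$ are finite, and $$W^{\mathrm{BTS}}\;\ge\; W^{\mathrm{IRS.FH}}\;\ge\; W^{\mathrm{IRS.V\text{-}Zero}}\;\ge\; V^\star .$$ -/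

import Mathlib

open MeasureTheory ProbabilityTheory

universe u v

noncomputable section

namespace BudgetedMAB

/-- The law of an i.i.d. sequence depends measurably on the parameter. -/
theorem measurable_iid {T : Type*} [MeasurableSpace T] (κ : Kernel T ℝ) [IsMarkovKernel κ] :
    Measurable fun θ : T => Measure.infinitePi (fun _ : ℕ => κ θ) := by
  refine Measurable.measure_of_isPiSystem_of_isProbabilityMeasure
    (S := squareCylinders fun _ : ℕ => {s : Set ℝ | MeasurableSet s})
    generateFrom_squareCylinders.symm
    (isPiSystem_squareCylinders (fun _ => MeasurableSpace.isPiSystem_measurableSet)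
      fun _ => by simp) ?_
  rintro A ⟨s, t, ht, rfl⟩
  have ht' : ∀ i, MeasurableSet (t i) := fun i => ht i (Set.mem_univ i)
  have h : (fun θ : T => Measure.infinitePi (fun _ : ℕ => κ θ) ((s : Set ℕ).pi t))
      = fun θ => ∏ i ∈ s, κ θ (t i) := by
    funext θ
    exact Measure.infinitePi_pi (fun _ : ℕ => κ θ) fun i _ => ht' i
  rw [h]
  exact Finset.measurable_prod _ fun i _ => Kernel.measurable_coe κ (ht' i)

/-- Given the parameter `θ`, an i.i.d. sequence of rewards with law `κ θ`. -/
def iidKernel {T : Type*} [MeasurableSpace T] (κ : Kernel T ℝ) [IsMarkovKernel κ] :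
    Kernel T (ℕ → ℝ) where
  toFun θ := Measure.infinitePi (fun _ : ℕ => κ θ)
  measurable' := measurable_iid κ

instance {T : Type*} [MeasurableSpace T] (κ : Kernel T ℝ) [IsMarkovKernel κ] :
    IsMarkovKernel (iidKernel κ) :=
  ⟨fun θ => inferInstanceAs (IsProbabilityMeasure (Measure.infinitePi (fun _ : ℕ => κ θ)))⟩

/-- An instance `(K, B, (c_a, R_a, Θ_a, P_a, Y_a, y_{a,0})_a)` of the Bayesian budgeted multi-armed
bandit problem with deterministic costs. -/
structure Instance (K : ℕ) where
  /-- the resource budget -/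
  B : ℕ
  /-- the cost of a play of each arm, a positive integer -/
  c : Fin K → ℕ
  c_pos : ∀ a, 0 < c a
  /-- the parameter space of each arm -/
  Θ : Fin K → Type u
  [measurableSpaceΘ : ∀ a, MeasurableSpace (Θ a)]
  /-- the reward distribution of each arm, given its parameter -/
  reward : ∀ a, Kernel (Θ a) ℝ
  [isMarkovKernel_reward : ∀ a, IsMarkovKernel (reward a)]
  /-- rewards are nonnegative -/
  reward_nonneg : ∀ a θ, ∀ᵐ r ∂(reward a θ), 0 ≤ r
  /-- the belief space (hyperparameters) of each arm -/
  Y : Fin K → Type v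
  /-- the distribution of the parameter under each belief -/
  prior : ∀ a, Y a → Measure (Θ a)
  [isProbabilityMeasure_prior : ∀ a y, IsProbabilityMeasure (prior a y)]
  /-- the initial belief about each arm -/
  y₀ : ∀ a, Y a
  /-- under the initial belief, the reward of a play has a finite mean (so that the mean rewards and
  their Bayesian estimates are real numbers) -/
  integrable_reward : ∀ a, Integrable (fun r : ℝ => r) ((prior a (y₀ a)).bind (reward a))

attribute [instance] Instance.measurableSpaceΘ Instance.isMarkovKernel_reward
  Instance.isProbabilityMeasure_prior

namespace Instance

variable {K : ℕ} (M : Instance.{u, v} K)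

/-- The parameter of arm `a` together with its sequence of rewards; the reward of the `n`-th pull
(`n ≥ 1`) is the entry with index `n - 1`. -/
abbrev ArmOutcome (a : Fin K) : Type u := M.Θ a × (ℕ → ℝ)

/-- The joint law of `(θ_a, (R_{a,n})_n)`: the parameter is drawn from the prior and, given the
parameter, the rewards are i.i.d. -/
def armLaw (a : Fin K) : Measure (M.ArmOutcome a) :=
  (M.prior a (M.y₀ a)).compProd (iidKernel (M.reward a))

instance (a : Fin K) : IsProbabilityMeasure (M.armLaw a) := by
  unfold armLaw; infer_instance

/-- Parameters and rewards of all arms. -/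
abbrev Outcome : Type u := ∀ a, M.ArmOutcome a

/-- The law of parameters and rewards of all arms; the arms are independent. -/
def law : Measure M.Outcome := Measure.pi M.armLaw

instance : IsProbabilityMeasure M.law := by
  unfold law; infer_instance

/-- The mean reward `μ_a(θ_a)`. -/
def mean (a : Fin K) (θ : M.Θ a) : ℝ := ∫ r, r ∂(M.reward a θ)

/-- The first `n` rewards `R_{a,1:n}` of arm `a`. -/
def firstRewards (a : Fin K) (n : ℕ) (o : M.ArmOutcome a) : Fin n → ℝ := fun i => o.2 i

/-- The `n`-sample Bayesian estimate `μ̂_{a,n}(r_{1:n})`, that is `E[μ_a(θ_a) | R_{a,1:n} = r_{1:n}]`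
for the initial belief. -/
def estimate (a : Fin K) (n : ℕ) (r : Fin n → ℝ) : ℝ :=
  ∫ m, m ∂(condDistrib (fun o : M.ArmOutcome a => M.mean a o.1) (M.firstRewards a n)
    (M.armLaw a) r)

/-- The random variable `μ̂_{a,n}(R_{a,1:n})`. -/
def muHat (a : Fin K) (n : ℕ) (ω : M.Outcome) : ℝ := M.estimate a n (M.firstRewards a n (ω a))

/-- `B × max_a μ_a(θ_a) / c_a`. -/
def payoffBTS (ω : M.Outcome) : ℝ := M.B * ⨆ a, M.mean a (ω a).1 / M.c a

/-- `B × max_a μ̂_{a, ⌊B/c_a⌋ - 1} / c_a`. The subtraction is truncated: for an arm with `B < c_a`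
the estimate is the prior mean. -/
def payoffFH (ω : M.Outcome) : ℝ := M.B * ⨆ a, M.muHat a (M.B / M.c a - 1) ω / M.c a

/-- `max_n ∑_a ∑_{i=1}^{n_a} μ̂_{a,i-1}`, over the (finitely many) integer allocations `n` that
respect the budget. -/
def payoffVZero (ω : M.Outcome) : ℝ :=
  ⨆ n : {n : Fin K → ℕ // ∑ a, M.c a * n a ≤ M.B},
    ∑ a, ∑ i ∈ Finset.range (n.1 a), M.muHat a i ω

def WBTS : ℝ := ∫ ω, M.payoffBTS ω ∂M.law

def WFH : ℝ := ∫ ω, M.payoffFH ω ∂M.law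

def WVZero : ℝ := ∫ ω, M.payoffVZero ω ∂M.law

end Instance

/-- A (possibly randomized) admissible policy for `K` arms: `choose t s h` is the arm played at
time `t + 1`, where `h` lists the arms played and the rewards received at the times `1, …, t`, and
`s` is a random seed, independent of parameters and rewards. -/
structure Policy (K : ℕ) where
  Seed : Type
  [measurableSpaceSeed : MeasurableSpace Seed]
  seedLaw : Measure Seed
  [isProbabilityMeasure_seedLaw : IsProbabilityMeasure seedLaw]
  choose : ∀ t : ℕ, Seed → (Fin t → Fin K × ℝ) → Fin K
  measurable_choose : ∀ t, Measurable fun p : Seed × (Fin t → Fin K × ℝ) => choose t p.1 p.2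

attribute [instance] Policy.measurableSpaceSeed Policy.isProbabilityMeasure_seedLaw

namespace Policy

variable {K : ℕ} (π : Policy K)

/-- The arms played and the rewards received at the times `1, …, t`, when `R a j` is the reward of
the `(j + 1)`-th pull of arm `a`. -/
def history (s : π.Seed) (R : Fin K → ℕ → ℝ) : ∀ t : ℕ, Fin t → Fin K × ℝ
  | 0 => Fin.elim0
  | t + 1 =>
    let h := history s R t
    let a := π.choose t s h
    let pulls := (Finset.univ.filter fun i : Fin t => (h i).1 = a).card
    Fin.snoc (α := fun _ => Fin K × ℝ) h (a, R a pulls)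

/-- The arm `A_{t+1}` played at time `t + 1`. -/
def arm (s : π.Seed) (R : Fin K → ℕ → ℝ) (t : ℕ) : Fin K :=
  (π.history s R (t + 1) (Fin.last t)).1

/-- The reward `r_{t+1}` received at time `t + 1`. -/
def gain (s : π.Seed) (R : Fin K → ℕ → ℝ) (t : ℕ) : ℝ :=
  (π.history s R (t + 1) (Fin.last t)).2

/-- The first time `τ` at which the cumulative cost exceeds the budget. -/
def stopTime (c : Fin K → ℕ) (B : ℕ) (s : π.Seed) (R : Fin K → ℕ → ℝ) : ℕ :=
  sInf {t : ℕ | B < ∑ i ∈ Finset.range t, c (π.arm s R i)}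

/-- The collected reward `∑_{t=1}^{τ-1} r_t`. -/
def totalReward (M : Instance.{u, v} K) (p : π.Seed × M.Outcome) : ℝ :=
  ∑ t ∈ Finset.range (π.stopTime M.c M.B p.1 (fun a => (p.2 a).2) - 1),
    π.gain p.1 (fun a => (p.2 a).2) t

/-- The expected performance `V(π)`. -/
def value (M : Instance.{u, v} K) : ℝ :=
  ∫ p, π.totalReward M p ∂(π.seedLaw.prod M.law)

end Policy

/-- The Bayes-optimal value `V⋆ = sup_π V(π)`. -/
def Instance.optValue {K : ℕ} (M : Instance.{u, v} K) : ℝ := ⨆ π : Policy K, π.value M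

end BudgetedMAB

end

/-!
Each of the three inequalities reveals more information about the arms.

*Policies against step-by-step estimates* (`Policy.value_le_WVZero`). For a fixed seed, whether the
pull number `i + 1` of arm `a` takes place within the budget is decided by the other arms and by the
first `i` rewards of arm `a` (`Policy.Plays.congr`). Given this information, the reward of the pull
has the conditional expectation `μ̂_{a,i}` (`setIntegral_reward_eq_estimate`). So a policy earns in
expectation the sum of the estimates `μ̂_{a,i}` over its pulls, and these pulls form an allocation
that respects the budget, whose value is at most the maximum over all allocations.

*Step-by-step estimates against finite-horizon estimates* (`WVZero_le_WFH`). The estimates of an arm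
form a martingale. The point is that the expected maximum over allocations can only grow if all
estimates of an arm are replaced by the last one. The maximising allocation anticipates later
rewards, so this is not a plain instance of Jensen's inequality. Fix the contribution `C` of the
other arms, and replace the entries `x k` backwards, for decreasing `k`, by the last estimate `y`.
The increase of the maximum is at least `y - x k` if an optimal allocation for
`x 0, …, x k, x k, …` has more than `k` pulls of the arm, and at least `0` otherwise
(`bestPrefix_splice_add_le`). This alternative depends only on `x 0, …, x k`, while `y - x k` has
conditional mean zero given the first `k` rewards, so the expected increase is nonnegative. The arms
are independent and are treated one after the other (`integral_ciSup_sum_prefix_le`). Once each arm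
has a constant nonnegative value per pull, an allocation is worth no more than spending the budget
at the best ratio of value and cost (`sum_mul_le_budget_mul_ciSup`).

*Finite-horizon estimates against the true means* (`WFH_le_WBTS`). A maximum over the arms is a
maximum over allocations of a single pull, so that the same replacement applies, from
`μ̂_{a,m}` to `μ_a(θ_a)`, of which it is the conditional expectation.
-/

namespace BudgetedMAB

/-! ### Optimal prefixes of a single sequence -/

/-- The best total of a constant `C n` and a prefix sum of `w` of length `q n`, over all `n`. -/
noncomputable def bestPrefix {N : Type*} (C : N → ℝ) (q : N → ℕ) (w : ℕ → ℝ) : ℝ :=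
  ⨆ n, (C n + ∑ i ∈ Finset.range (q n), w i)

/-- The sequence that agrees with `x` before the index `k` and is constantly `y` from `k` on. -/
def splice (k : ℕ) (x : ℕ → ℝ) (y : ℝ) : ℕ → ℝ := fun i => if i < k then x i else y

theorem sum_splice (k : ℕ) (x : ℕ → ℝ) (y : ℝ) (j : ℕ) :
    ∑ i ∈ Finset.range j, splice k x y i
      = ∑ i ∈ Finset.range (min j k), x i + ((j - k : ℕ) : ℝ) * y := by
  induction j with
  | zero => simp
  | succ j ih =>
    rw [Finset.sum_range_succ, ih]
    rcases lt_or_ge j k with h | h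
    · rw [min_eq_left h.le, min_eq_left (show j + 1 ≤ k from h), Finset.sum_range_succ,
        Nat.sub_eq_zero_of_le h.le, Nat.sub_eq_zero_of_le (show j + 1 ≤ k from h)]
      simp [splice, h]
    · rw [min_eq_right h, min_eq_right (by omega), show j + 1 - k = (j - k) + 1 by omega]
      simp only [splice, if_neg (not_lt.mpr h)]
      push_cast
      ring

theorem sum_splice_of_le {k j : ℕ} (h : j ≤ k) (x : ℕ → ℝ) (y : ℝ) :
    ∑ i ∈ Finset.range j, splice k x y i = ∑ i ∈ Finset.range j, x i := by
  rw [sum_splice, min_eq_left h, Nat.sub_eq_zero_of_le h]; simp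

theorem sum_splice_of_lt {k j : ℕ} (h : k < j) (x : ℕ → ℝ) (y : ℝ) :
    ∑ i ∈ Finset.range j, splice k x y i
      = ∑ i ∈ Finset.range k, x i + ((j - k - 1 : ℕ) : ℝ) * y + y := by
  rw [sum_splice, min_eq_right h.le]
  obtain ⟨d, rfl⟩ := Nat.exists_eq_add_of_lt h
  rw [show k + d + 1 - k = d + 1 by omega]
  simp; ring

theorem sum_splice_succ_of_lt {k j : ℕ} (h : k < j) (x : ℕ → ℝ) (y : ℝ) :
    ∑ i ∈ Finset.range j, splice (k + 1) x y i
      = ∑ i ∈ Finset.range k, x i + ((j - k - 1 : ℕ) : ℝ) * y + x k := by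
  rw [sum_splice, min_eq_right (show k + 1 ≤ j from h), Finset.sum_range_succ,
    show j - (k + 1) = j - k - 1 by omega]
  ring

/-- Some optimal prefix of `x 0, …, x (k - 1), x k, x k, …` is longer than `k`. -/
def PassesIndex {N : Type*} (C : N → ℝ) (q : N → ℕ) (k : ℕ) (x : ℕ → ℝ) : Prop :=
  ∃ n, k < q n ∧ ∀ n', C n' + ∑ i ∈ Finset.range (q n'), splice k x (x k) i
    ≤ C n + ∑ i ∈ Finset.range (q n), splice k x (x k) i

theorem bestPrefix_congr {N : Type*} (C : N → ℝ) {q : N → ℕ} {w w' : ℕ → ℝ}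
    (h : ∀ n, ∀ i < q n, w i = w' i) : bestPrefix C q w = bestPrefix C q w' := by
  unfold bestPrefix
  congr 1
  funext n
  rw [Finset.sum_congr rfl fun i hi => h n i (Finset.mem_range.mp hi)]

open Classical in
/-- Replacing the entry `x k` of `x 0, …, x k, y, y, …` by `y` changes the best prefix total by at
least `y - x k` or `0`. Which of the two is decided by `x 0, …, x k` alone: the prefixes longer than
`k` gain with `y` and the others do not depend on it, so it is enough to know which kind is optimal
at `y = x k`. -/
theorem bestPrefix_splice_add_le {N : Type*} [Finite N] [Nonempty N] (C : N → ℝ) (q : N → ℕ)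
    (k : ℕ) (x : ℕ → ℝ) (y : ℝ) :
    bestPrefix C q (splice (k + 1) x y) + (if PassesIndex C q k x then y - x k else 0)
      ≤ bestPrefix C q (splice k x y) := by
  rw [← le_sub_iff_add_le]
  refine ciSup_le fun n' => ?_
  rw [le_sub_iff_add_le]
  have key : ∀ n, C n' + ∑ i ∈ Finset.range (q n'), splice (k + 1) x y i
      + (if PassesIndex C q k x then y - x k else 0)
        ≤ C n + ∑ i ∈ Finset.range (q n), splice k x y i →
      C n' + ∑ i ∈ Finset.range (q n'), splice (k + 1) x y i
        + (if PassesIndex C q k x then y - x k else 0) ≤ bestPrefix C q (splice k x y) :=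
    fun n h => h.trans (le_ciSup (f := fun n => C n + ∑ i ∈ Finset.range (q n), splice k x y i)
      (Set.finite_range _).bddAbove n)
  -- The total of a prefix not longer than `k` does not depend on what follows `x (k - 1)`.
  have short : ∀ n, q n ≤ k → ∀ z, ∑ i ∈ Finset.range (q n), splice k x z i
      = ∑ i ∈ Finset.range (q n), splice (k + 1) x y i := fun n h z => by
    rw [sum_splice_of_le h, sum_splice_of_le (h.trans (Nat.le_succ k))]
  by_cases hD : PassesIndex C q k x
  · simp only [if_pos hD] at key ⊢
    obtain ⟨n, hn, hmax⟩ := hD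
    rcases le_or_gt (q n') k with h' | h'
    · rcases le_total (x k) y with hy | hy
      · refine key n ?_
        have h1 := hmax n'
        rw [short n' h', sum_splice_of_lt hn] at h1
        rw [sum_splice_of_lt hn]
        have : ((q n - k - 1 : ℕ) : ℝ) * x k ≤ ((q n - k - 1 : ℕ) : ℝ) * y := by gcongr
        linarith
      · refine key n' ?_
        rw [short n' h']
        linarith
    · refine key n' ?_
      rw [sum_splice_of_lt h', sum_splice_succ_of_lt h']
      linarith
  · simp only [if_neg hD, add_zero] at key ⊢
    rcases le_or_gt (q n') k with h' | h'
    · refine key n' ?_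
      rw [short n' h']
    · rcases le_total (x k) y with hy | hy
      · refine key n' ?_
        rw [sum_splice_of_lt h', sum_splice_succ_of_lt h']
        linarith
      · obtain ⟨n, hn⟩ := Finite.exists_max
          fun n => C n + ∑ i ∈ Finset.range (q n), splice k x (x k) i
        have hnk : q n ≤ k := by
          by_contra hc
          exact hD ⟨n, not_le.mp hc, hn⟩
        refine key n ?_
        rw [short n hnk]
        have h1 := hn n'
        rw [sum_splice_of_lt h', short n hnk] at h1
        rw [sum_splice_succ_of_lt h']
        have : ((q n' - k - 1 : ℕ) : ℝ) * y ≤ ((q n' - k - 1 : ℕ) : ℝ) * x k := by gcongr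
        linarith

section Integral

variable {Ω : Type*} {m₀ : MeasurableSpace Ω} {μ : Measure Ω}

theorem integrable_ciSup {N : Type*} [Finite N] [Nonempty N] {f : N → Ω → ℝ}
    (hf : ∀ n, Integrable (f n) μ) : Integrable (fun ω => ⨆ n, f n ω) μ := by
  have := Fintype.ofFinite N
  refine (integrable_finsetSum Finset.univ fun n _ => (hf n).norm).mono'
    (AEMeasurable.iSup fun n => (hf n).aemeasurable).aestronglyMeasurable
    (Filter.Eventually.of_forall fun ω => ?_)
  have hle : ∀ n, ‖f n ω‖ ≤ ∑ n, ‖f n ω‖ := fun n =>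
    Finset.single_le_sum (f := fun n => ‖f n ω‖) (fun _ _ => norm_nonneg _) (Finset.mem_univ n)
  obtain ⟨n, hn⟩ := exists_eq_ciSup_of_finite (f := fun n => f n ω)
  rw [← hn]
  exact hle n

theorem measurableSet_passesIndex {N : Type*} [Finite N] {m : MeasurableSpace Ω}
    (C : N → ℝ) (q : N → ℕ) (k : ℕ) {x : ℕ → Ω → ℝ} (hx : ∀ i ≤ k, Measurable (x i)) :
    MeasurableSet {ω | PassesIndex C q k fun i => x i ω} := by
  have hs : ∀ i, Measurable fun ω => splice k (fun i => x i ω) (x k ω) i := by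
    intro i
    unfold splice
    split_ifs with h
    · exact hx i h.le
    · exact hx k le_rfl
  have hv : ∀ n, Measurable fun ω =>
      C n + ∑ i ∈ Finset.range (q n), splice k (fun i => x i ω) (x k ω) i :=
    fun n => measurable_const.add (Finset.measurable_sum _ fun i _ => hs i)
  have : {ω | PassesIndex C q k fun i => x i ω} = ⋃ n, ⋃ _ : k < q n, ⋂ n',
      {ω | C n' + ∑ i ∈ Finset.range (q n'), splice k (fun i => x i ω) (x k ω) i
        ≤ C n + ∑ i ∈ Finset.range (q n), splice k (fun i => x i ω) (x k ω) i} := by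
    ext ω
    simp [PassesIndex]
  rw [this]
  exact MeasurableSet.iUnion fun n => MeasurableSet.iUnion fun _ => MeasurableSet.iInter fun n' =>
    measurableSet_le (hv n') (hv n)

variable {N : Type*} [Finite N] [Nonempty N]

theorem integrable_bestPrefix (C : N → ℝ) (q : N → ℕ) {w : ℕ → Ω → ℝ} [IsFiniteMeasure μ]
    (hw : ∀ i, Integrable (w i) μ) :
    Integrable (fun ω => bestPrefix C q fun i => w i ω) μ :=
  integrable_ciSup fun n => (integrable_const (C n)).add
    (integrable_finsetSum (Finset.range (q n)) fun i _ => hw i)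

/-- If `x k` is the conditional expectation of `Y` given information that includes
`x 0, …, x k`, then revealing `Y` in place of `x k` can only increase the expected best prefix total
of `x 0, …, x k, Y, Y, …`. -/
theorem integral_bestPrefix_splice_succ_le {m : MeasurableSpace Ω} (hm : m ≤ m₀)
    [IsFiniteMeasure μ] (C : N → ℝ) (q : N → ℕ) (k : ℕ) {x : ℕ → Ω → ℝ} {Y : Ω → ℝ}
    (hx : ∀ i ≤ k, Measurable[m] (x i)) (hxi : ∀ i, Integrable (x i) μ) (hY : Integrable Y μ)
    (hxk : x k =ᵐ[μ] μ[Y | m]) :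
    ∫ ω, bestPrefix C q (splice (k + 1) (fun i => x i ω) (Y ω)) ∂μ
      ≤ ∫ ω, bestPrefix C q (splice k (fun i => x i ω) (Y ω)) ∂μ := by
  classical
  have hA : MeasurableSet[m] {ω | PassesIndex C q k fun i => x i ω} :=
    measurableSet_passesIndex C q k hx
  set A := {ω | PassesIndex C q k fun i => x i ω} with hAdef
  have hint : ∀ k, Integrable (fun ω => bestPrefix C q (splice k (fun i => x i ω) (Y ω))) μ := by
    intro k
    refine integrable_bestPrefix C q (w := fun i ω => splice k (fun i => x i ω) (Y ω) i) fun i => ?_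
    unfold splice
    split_ifs
    · exact hxi i
    · exact hY
  have hD : Integrable (A.indicator fun ω => Y ω - x k ω) μ := (hY.sub (hxi k)).indicator (hm _ hA)
  have hzero : ∫ ω, A.indicator (fun ω => Y ω - x k ω) ω ∂μ = 0 := by
    rw [integral_indicator (hm _ hA), integral_sub hY.integrableOn (hxi k).integrableOn,
      ← setIntegral_condExp hm hY hA,
      setIntegral_congr_ae (g := x k) (hm _ hA) (hxk.mono fun ω h _ => h.symm), sub_self]
  calc _ = ∫ ω, (bestPrefix C q (splice (k + 1) (fun i => x i ω) (Y ω))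
        + A.indicator (fun ω => Y ω - x k ω) ω) ∂μ := by
        rw [integral_add (hint _) hD, hzero, add_zero]
    _ ≤ _ := by
        refine integral_mono ((hint _).add hD) (hint _) fun ω => ?_
        have := bestPrefix_splice_add_le C q k (fun i => x i ω) (Y ω)
        simpa only [Set.indicator, hAdef, Set.mem_ofPred_eq] using this

/-- Replacing every entry of a martingale by its last value can only increase the expected best
prefix total. -/
theorem integral_bestPrefix_martingale_le [IsFiniteMeasure μ] {ℱ : Filtration ℕ m₀}
    {f : ℕ → Ω → ℝ} (hf : Martingale f ℱ μ) (C : N → ℝ) {q : N → ℕ} {j : ℕ}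
    (hq : ∀ n, q n ≤ j + 1) :
    ∫ ω, bestPrefix C q (fun i => f i ω) ∂μ ≤ ∫ ω, bestPrefix C q (fun _ => f j ω) ∂μ := by
  have step : ∀ k ≤ j, ∫ ω, bestPrefix C q (splice (k + 1) (fun i => f i ω) (f j ω)) ∂μ
      ≤ ∫ ω, bestPrefix C q (splice k (fun i => f i ω) (f j ω)) ∂μ := fun k hk =>
    integral_bestPrefix_splice_succ_le (ℱ.le k) C q k
      (fun i hi => ((hf.1 i).measurable).mono (ℱ.mono hi) le_rfl) hf.integrable (hf.integrable j)
      (hf.2 k j hk).symm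
  have all : ∀ k ≤ j + 1, ∫ ω, bestPrefix C q (splice k (fun i => f i ω) (f j ω)) ∂μ
      ≤ ∫ ω, bestPrefix C q (splice 0 (fun i => f i ω) (f j ω)) ∂μ := by
    intro k
    induction k with
    | zero => exact fun _ => le_rfl
    | succ k ih => exact fun hk => (step k (by omega)).trans (ih (by omega))
  have h := all (j + 1) le_rfl
  have h1 : ∀ ω, bestPrefix C q (splice (j + 1) (fun i => f i ω) (f j ω))
      = bestPrefix C q (fun i => f i ω) := fun ω =>
    bestPrefix_congr C fun n i hi => by simp [splice, hi.trans_le (hq n)]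
  have h2 : ∀ ω, splice 0 (fun i => f i ω) (f j ω) = fun _ => f j ω := fun ω => by
    funext i; simp [splice]
  simpa only [h1, h2] using h

/-- Jensen's inequality for best prefix totals: if all prefixes have length at most one, replacing a
conditional expectation `X` by the random variable `Y` itself can only increase the expectation. -/
theorem integral_bestPrefix_condExp_le {m : MeasurableSpace Ω} (hm : m ≤ m₀)
    [IsFiniteMeasure μ] (C : N → ℝ) {q : N → ℕ} (hq : ∀ n, q n ≤ 1) {X Y : Ω → ℝ}
    (hX : Measurable[m] X) (hXi : Integrable X μ) (hY : Integrable Y μ) (hXY : X =ᵐ[μ] μ[Y | m]) :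
    ∫ ω, bestPrefix C q (fun _ => X ω) ∂μ ≤ ∫ ω, bestPrefix C q (fun _ => Y ω) ∂μ := by
  have h := integral_bestPrefix_splice_succ_le hm C q 0 (x := fun _ => X) (fun _ _ => hX)
    (fun _ => hXi) hY hXY
  have h1 : ∀ ω, bestPrefix C q (splice (0 + 1) (fun _ => X ω) (Y ω))
      = bestPrefix C q (fun _ => X ω) := fun ω =>
    bestPrefix_congr C fun n i hi => by simp [splice, hi.trans_le (hq n)]
  have h2 : ∀ ω, splice 0 (fun _ => X ω) (Y ω) = fun _ => Y ω := fun ω => by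
    funext i; simp [splice]
  simpa only [h1, h2] using h

end Integral

/-! ### Resampling one coordinate of a product measure -/

section Resample

variable {ι : Type*} [Fintype ι] {X : ι → Type*} [∀ i, MeasurableSpace (X i)]
  {μ : ∀ i, Measure (X i)} [∀ i, IsProbabilityMeasure (μ i)]

theorem integrable_pi_eval (a : ι) {f : X a → ℝ} (hf : Integrable f (μ a)) :
    Integrable (fun ω : ∀ i, X i => f (ω a)) (Measure.pi μ) :=
  (measurePreserving_eval μ a).integrable_comp_of_integrable hf

variable {N : Type*} [Finite N] [Nonempty N]

theorem integrable_ciSup_sum_prefix (q : N → ι → ℕ) {w : ∀ a, ℕ → X a → ℝ}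
    (hw : ∀ a i, Integrable (w a i) (μ a)) :
    Integrable (fun ω : ∀ i, X i => ⨆ n, ∑ a, ∑ i ∈ Finset.range (q n a), w a i (ω a))
      (Measure.pi μ) :=
  integrable_ciSup fun _ => integrable_finsetSum _ fun a _ => integrable_finsetSum _ fun i _ =>
    integrable_pi_eval a (hw a i)

variable [DecidableEq ι]

variable (μ) in
theorem measurePreserving_update (a : ι) :
    MeasurePreserving (fun p : (∀ i, X i) × X a => Function.update p.1 a p.2)
      ((Measure.pi μ).prod (μ a)) (Measure.pi μ) := by
  refine ⟨measurable_update', (Measure.pi_eq fun s hs => ?_).symm⟩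
  rw [Measure.map_apply (measurable_update') (MeasurableSet.univ_pi hs)]
  have : (fun p : (∀ i, X i) × X a => Function.update p.1 a p.2) ⁻¹' (Set.univ.pi s)
      = Set.univ.pi (Function.update s a Set.univ) ×ˢ s a := by
    ext p
    simp only [Set.mem_preimage, Set.mem_pi, Set.mem_univ, true_implies, Set.mem_prod]
    constructor
    · refine fun h => ⟨fun i => ?_, by simpa using h a⟩
      by_cases hi : i = a
      · subst hi; simp
      · simpa [hi] using h i
    · rintro ⟨h, ha⟩ i
      by_cases hi : i = a
      · subst hi; simpa using ha
      · simpa [hi] using h i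
  rw [this, Measure.prod_prod, Measure.pi_pi, ← Finset.prod_erase_mul _ _ (Finset.mem_univ a),
    ← Finset.prod_erase_mul Finset.univ (fun i => μ i (s i)) (Finset.mem_univ a)]
  rw [Finset.prod_congr rfl fun i hi => by
    rw [Function.update_of_ne (Finset.ne_of_mem_erase hi)]]
  simp

theorem integral_pi_eq_integral_update (a : ι) {f : (∀ i, X i) → ℝ}
    (hf : Integrable f (Measure.pi μ)) :
    ∫ ω, f ω ∂Measure.pi μ = ∫ ω, ∫ o, f (Function.update ω a o) ∂μ a ∂Measure.pi μ := by
  have hmp := measurePreserving_update μ a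
  have hint : Integrable (fun p : (∀ i, X i) × X a => f (Function.update p.1 a p.2))
      ((Measure.pi μ).prod (μ a)) := hmp.integrable_comp_of_integrable hf
  rw [← integral_prod _ hint]
  conv_lhs => rw [← hmp.map_eq]
  refine integral_map hmp.measurable.aemeasurable ?_
  rw [hmp.map_eq]
  exact hf.aestronglyMeasurable

/-- Integrals over a product can be compared one coordinate at a time. -/
theorem integral_pi_mono_of_update (a : ι) {f g : (∀ i, X i) → ℝ}
    (hf : Integrable f (Measure.pi μ)) (hg : Integrable g (Measure.pi μ))
    (h : ∀ ω, ∫ o, f (Function.update ω a o) ∂μ a ≤ ∫ o, g (Function.update ω a o) ∂μ a) :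
    ∫ ω, f ω ∂Measure.pi μ ≤ ∫ ω, g ω ∂Measure.pi μ := by
  have hmp := measurePreserving_update μ a
  rw [integral_pi_eq_integral_update a hf, integral_pi_eq_integral_update a hg]
  exact integral_mono (hmp.integrable_comp_of_integrable hf).integral_prod_left
    (hmp.integrable_comp_of_integrable hg).integral_prod_left h

/-- A comparison of expected best prefix totals that holds for each arm, whatever the other arms
contribute, holds for all arms together: the arms are independent and can be exchanged one by
one. -/
theorem integral_ciSup_sum_prefix_le (q : N → ι → ℕ) {w w' : ∀ a, ℕ → X a → ℝ}
    (hw : ∀ a i, Integrable (w a i) (μ a)) (hw' : ∀ a i, Integrable (w' a i) (μ a))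
    (h : ∀ a (C : N → ℝ), ∫ o, bestPrefix C (fun n => q n a) (fun i => w a i o) ∂μ a
      ≤ ∫ o, bestPrefix C (fun n => q n a) (fun i => w' a i o) ∂μ a) :
    ∫ ω, (⨆ n, ∑ a, ∑ i ∈ Finset.range (q n a), w a i (ω a)) ∂Measure.pi μ
      ≤ ∫ ω, (⨆ n, ∑ a, ∑ i ∈ Finset.range (q n a), w' a i (ω a)) ∂Measure.pi μ := by
  let z : Finset ι → ∀ a, ℕ → X a → ℝ := fun S a => if a ∈ S then w' a else w a
  have hz : ∀ S a i, Integrable (z S a i) (μ a) := by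
    intro S a i
    simp only [z]
    split_ifs
    · exact hw' a i
    · exact hw a i
  have main : ∀ S : Finset ι,
      ∫ ω, (⨆ n, ∑ a, ∑ i ∈ Finset.range (q n a), w a i (ω a)) ∂Measure.pi μ
        ≤ ∫ ω, (⨆ n, ∑ a, ∑ i ∈ Finset.range (q n a), z S a i (ω a)) ∂Measure.pi μ := by
    intro S
    induction S using Finset.induction_on with
    | empty => simp [z]
    | insert a S ha ih =>
      refine ih.trans (integral_pi_mono_of_update a (integrable_ciSup_sum_prefix q (hz S))
        (integrable_ciSup_sum_prefix q (hz _)) fun ω => ?_)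
      have e : ∀ T : Finset ι, T.erase a = S → ∀ o,
          (⨆ n, ∑ b, ∑ i ∈ Finset.range (q n b), z T b i (Function.update ω a o b))
          = bestPrefix
              (fun n => ∑ b ∈ Finset.univ.erase a, ∑ i ∈ Finset.range (q n b), z S b i (ω b))
              (fun n => q n a) fun i => z T a i o := by
        intro T hT o
        unfold bestPrefix
        congr 1
        funext n
        rw [← Finset.sum_erase_add _ _ (Finset.mem_univ a), Function.update_self]
        congr 1
        refine Finset.sum_congr rfl fun b hb => ?_
        have hba := Finset.ne_of_mem_erase hb
        have : z T b = z S b := by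
          simp only [z, ← hT, Finset.mem_erase, hba, ne_eq, not_false_eq_true, true_and]
        rw [Function.update_of_ne hba, this]
      simp only [e S (Finset.erase_eq_of_notMem ha), e (insert a S) (Finset.erase_insert ha)]
      have h1 : z S a = w a := by simp [z, ha]
      have h2 : z (insert a S) a = w' a := by simp [z]
      rw [h1, h2]
      exact h a _
  simpa [z] using main Finset.univ

end Resample

/-! ### A single arm: rewards, mean reward and Bayesian estimates -/

theorem iidKernel_map_eval {T : Type*} [MeasurableSpace T] (κ : Kernel T ℝ) [IsMarkovKernel κ]
    (i : ℕ) : (iidKernel κ).map (fun r => r i) = κ := by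
  ext1 θ
  rw [Kernel.map_apply _ (measurable_pi_apply i)]
  exact Measure.infinitePi_map_eval (fun _ : ℕ => κ θ) i

/-- In an i.i.d. sequence, the entry `i` is uncorrelated with events that depend on the entries
before it. -/
theorem integral_indicator_mul_iid {ν : Measure ℝ} [IsProbabilityMeasure ν] (i : ℕ)
    {s : Set (Fin i → ℝ)} (hs : MeasurableSet s) :
    ∫ r, s.indicator 1 (fun j : Fin i => r j) * r i ∂Measure.infinitePi (fun _ : ℕ => ν)
      = (∫ r, s.indicator 1 (fun j : Fin i => r j) ∂Measure.infinitePi (fun _ : ℕ => ν))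
        * ∫ x, x ∂ν := by
  have hind := (iIndepFun_infinitePi (P := fun _ : ℕ => ν) (X := fun _ x => x)
    fun _ => measurable_id).indepFun_finset (Finset.range i) {i} (by simp)
    fun j => measurable_pi_apply j
  have hφ : Measurable fun r : Finset.range i → ℝ =>
      s.indicator (1 : (Fin i → ℝ) → ℝ) fun j : Fin i => r ⟨j, Finset.mem_range.mpr j.2⟩ :=
    (measurable_one.indicator hs).comp
      (measurable_pi_lambda _ fun j => measurable_pi_apply _)
  have hψ : Measurable fun r : ({i} : Finset ℕ) → ℝ => r ⟨i, Finset.mem_singleton_self i⟩ :=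
    measurable_pi_apply _
  have h := hind.comp hφ hψ
  have hm : Measurable fun r : ℕ → ℝ => s.indicator (1 : (Fin i → ℝ) → ℝ) fun j : Fin i => r j :=
    (measurable_one.indicator hs).comp (measurable_pi_lambda _ fun j => measurable_pi_apply _)
  have := IndepFun.integral_fun_mul_eq_mul_integral h hm.aestronglyMeasurable
    (measurable_pi_apply i).aestronglyMeasurable
  refine Eq.trans this ?_
  congr 1
  have e := Measure.infinitePi_map_eval (fun _ : ℕ => ν) i
  conv_rhs => rw [← e]
  exact (integral_map (φ := fun r : ℕ → ℝ => r i) (f := fun x => x)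
    (measurable_pi_apply i).aemeasurable measurable_id.aestronglyMeasurable).symm

section Arm

variable {K : ℕ} (M : Instance.{u, v} K) (a : Fin K)

theorem mean_nonneg (θ : M.Θ a) : 0 ≤ M.mean a θ := integral_nonneg_of_ae (M.reward_nonneg a θ)

theorem map_armLaw_reward (i : ℕ) :
    (M.armLaw a).map (Prod.map id fun r : ℕ → ℝ => r i)
      = (M.prior a (M.y₀ a)).compProd (M.reward a) := by
  rw [Instance.armLaw, ← Measure.compProd_map (measurable_pi_apply i), iidKernel_map_eval]

theorem integrable_snd_compProd_reward :
    Integrable (fun p : M.Θ a × ℝ => p.2) ((M.prior a (M.y₀ a)).compProd (M.reward a)) := by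
  rw [Measure.integrable_compProd_snd_iff (f := fun r : ℝ => r)
    measurable_id.aestronglyMeasurable]
  exact M.integrable_reward a

theorem integrable_reward_apply (i : ℕ) :
    Integrable (fun o : M.ArmOutcome a => o.2 i) (M.armLaw a) := by
  have h := integrable_snd_compProd_reward M a
  rw [← map_armLaw_reward M a i] at h
  exact h.comp_measurable (measurable_id.prodMap (measurable_pi_apply i))

theorem integrable_mean : Integrable (fun o : M.ArmOutcome a => M.mean a o.1) (M.armLaw a) := by
  have h : Integrable (M.mean a) (M.prior a (M.y₀ a)) :=
    Integrable.integral_compProd (integrable_snd_compProd_reward M a)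
  have e : (M.armLaw a).map Prod.fst = M.prior a (M.y₀ a) := Measure.fst_compProd _ _
  rw [← e] at h
  exact h.comp_measurable measurable_fst

theorem measurable_firstRewards (n : ℕ) : Measurable (M.firstRewards a n) :=
  measurable_pi_lambda _ fun j => (measurable_pi_apply (j : ℕ)).comp measurable_snd

/-- The information of the successive rewards of an arm. -/
def rewardFiltration : Filtration ℕ (inferInstance : MeasurableSpace (M.ArmOutcome a)) where
  seq n := MeasurableSpace.comap (M.firstRewards a n) inferInstance
  mono' i j hij := by
    have : M.firstRewards a i = (fun r k => r (Fin.castLE hij k)) ∘ M.firstRewards a j := rfl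
    simp only
    rw [this, ← MeasurableSpace.comap_comp]
    exact MeasurableSpace.comap_mono
      (measurable_pi_lambda _ fun k => measurable_pi_apply _).comap_le
  le' n := (measurable_firstRewards M a n).comap_le

theorem estimate_ae_eq_condExp (n : ℕ) :
    (fun o => M.estimate a n (M.firstRewards a n o))
      =ᵐ[M.armLaw a] (M.armLaw a)[fun o => M.mean a o.1 | rewardFiltration M a n] :=
  (condExp_ae_eq_integral_condDistrib' (measurable_firstRewards M a n)
    (integrable_mean M a)).symm

theorem measurable_estimate (n : ℕ) : Measurable (M.estimate a n) :=
  (measurable_id.stronglyMeasurable.integral_kernel (κ := condDistrib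
    (fun o : M.ArmOutcome a => M.mean a o.1) (M.firstRewards a n) (M.armLaw a))).measurable

theorem measurable_estimate_firstRewards (n : ℕ) :
    Measurable[rewardFiltration M a n] fun o => M.estimate a n (M.firstRewards a n o) :=
  (measurable_estimate M a n).comp (comap_measurable _)

theorem integrable_estimate (n : ℕ) :
    Integrable (fun o => M.estimate a n (M.firstRewards a n o)) (M.armLaw a) :=
  integrable_condExp.congr (estimate_ae_eq_condExp M a n).symm

theorem estimate_nonneg (n : ℕ) :
    ∀ᵐ o ∂M.armLaw a, 0 ≤ M.estimate a n (M.firstRewards a n o) := by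
  have h : 0 ≤ᵐ[M.armLaw a] (M.armLaw a)[fun o => M.mean a o.1 | rewardFiltration M a n] :=
    condExp_nonneg (Filter.Eventually.of_forall fun o => mean_nonneg M a o.1)
  filter_upwards [h, estimate_ae_eq_condExp M a n] with o h1 h2
  rw [h2]
  exact h1

theorem martingale_estimate :
    Martingale (fun n o => M.estimate a n (M.firstRewards a n o)) (rewardFiltration M a)
      (M.armLaw a) := by
  refine ⟨fun n => (measurable_estimate_firstRewards M a n).stronglyMeasurable,
    fun i j hij => ?_⟩
  calc _ =ᵐ[M.armLaw a] (M.armLaw a)[(M.armLaw a)[fun o => M.mean a o.1 | rewardFiltration M a j]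
        | rewardFiltration M a i] := condExp_congr_ae (estimate_ae_eq_condExp M a j)
    _ =ᵐ[M.armLaw a] (M.armLaw a)[fun o => M.mean a o.1 | rewardFiltration M a i] :=
        condExp_condExp_of_le ((rewardFiltration M a).mono hij) ((rewardFiltration M a).le j)
    _ =ᵐ[M.armLaw a] _ := (estimate_ae_eq_condExp M a i).symm

/-- On events that are decided by the first `i` rewards, the next reward is worth its estimate. -/
theorem setIntegral_reward_eq_estimate (i : ℕ) {A : Set (M.ArmOutcome a)}
    (hA : MeasurableSet[rewardFiltration M a i] A) :
    ∫ o in A, o.2 i ∂M.armLaw a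
      = ∫ o in A, M.estimate a i (M.firstRewards a i o) ∂M.armLaw a := by
  have hA' := (rewardFiltration M a).le i A hA
  rw [setIntegral_congr_ae hA' ((estimate_ae_eq_condExp M a i).mono fun o h _ => h),
    setIntegral_condExp ((rewardFiltration M a).le i) (integrable_mean M a) hA]
  obtain ⟨s, hs, rfl⟩ := hA
  have e : ∀ f : M.ArmOutcome a → ℝ, ∫ o in M.firstRewards a i ⁻¹' s, f o ∂M.armLaw a
      = ∫ o, s.indicator 1 (M.firstRewards a i o) * f o ∂M.armLaw a := by
    intro f
    rw [← integral_indicator hA']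
    congr 1
    funext o
    by_cases h : M.firstRewards a i o ∈ s <;> simp [h]
  have hi : ∀ f : M.ArmOutcome a → ℝ, Integrable f (M.armLaw a) →
      Integrable (fun o => s.indicator 1 (M.firstRewards a i o) * f o) (M.armLaw a) := by
    intro f hf
    refine (hf.indicator hA').congr (Filter.Eventually.of_forall fun o => ?_)
    by_cases h : M.firstRewards a i o ∈ s <;> simp [h]
  rw [e, e, Instance.armLaw, Measure.integral_compProd (hi _ (integrable_reward_apply M a i)),
    Measure.integral_compProd (hi _ (integrable_mean M a))]
  congr 1
  funext θ
  exact (integral_indicator_mul_iid (ν := M.reward a θ) i hs).trans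
    (integral_mul_const (M.mean a θ) _).symm

end Arm

/-! ### Pathwise bookkeeping of a policy -/

namespace Policy

variable {K : ℕ} (π : Policy K) (s : π.Seed) (R : Fin K → ℕ → ℝ)

/-- The number of pulls of arm `a` at the times `1, …, t`. -/
def pullCount (a : Fin K) (t : ℕ) : ℕ := ((Finset.range t).filter fun j => π.arm s R j = a).card

theorem history_apply (t : ℕ) (i : Fin t) : π.history s R t i = (π.arm s R i, π.gain s R i) := by
  induction t with
  | zero => exact i.elim0
  | succ t ih =>
    refine Fin.lastCases ?_ (fun j => ?_) i
    · rfl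
    · exact (Fin.snoc_castSucc (α := fun _ => Fin K × ℝ) _ _ j).trans (ih j)

theorem arm_eq_choose (t : ℕ) : π.arm s R t = π.choose t s (π.history s R t) :=
  congrArg Prod.fst (Fin.snoc_last (α := fun _ => Fin K × ℝ) _ _)

theorem card_filter_history (a : Fin K) (t : ℕ) :
    (Finset.univ.filter fun i : Fin t => (π.history s R t i).1 = a).card
      = π.pullCount s R a t := by
  simp only [history_apply, pullCount, Finset.card_filter]
  exact Fin.sum_univ_eq_sum_range (fun j => if π.arm s R j = a then 1 else 0) t

theorem gain_eq (t : ℕ) :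
    π.gain s R t = R (π.arm s R t) (π.pullCount s R (π.arm s R t) t) := by
  rw [← card_filter_history, arm_eq_choose]
  exact congrArg Prod.snd (Fin.snoc_last (α := fun _ => Fin K × ℝ) _ _)

theorem pullCount_succ (a : Fin K) (t : ℕ) :
    π.pullCount s R a (t + 1) = π.pullCount s R a t + if π.arm s R t = a then 1 else 0 := by
  simp only [pullCount, Finset.card_filter, Finset.sum_range_succ]

theorem sum_gain (T : ℕ) : ∑ t ∈ Finset.range T, π.gain s R t
    = ∑ a, ∑ i ∈ Finset.range (π.pullCount s R a T), R a i := by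
  induction T with
  | zero => simp [pullCount]
  | succ T ih =>
    rw [Finset.sum_range_succ, ih, gain_eq,
      ← Finset.sum_erase_add _ _ (Finset.mem_univ (π.arm s R T)),
      ← Finset.sum_erase_add Finset.univ (fun a => ∑ i ∈ Finset.range (π.pullCount s R a (T + 1)),
        R a i) (Finset.mem_univ (π.arm s R T))]
    rw [pullCount_succ π s R (π.arm s R T), if_pos rfl, Finset.sum_range_succ, add_assoc]
    congr 1
    refine Finset.sum_congr rfl fun a ha => ?_
    rw [pullCount_succ, if_neg (Finset.ne_of_mem_erase ha).symm, add_zero]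

theorem sum_cost_mul_pullCount (c : Fin K → ℕ) (T : ℕ) :
    ∑ a, c a * π.pullCount s R a T = ∑ t ∈ Finset.range T, c (π.arm s R t) := by
  induction T with
  | zero => simp [pullCount]
  | succ T ih =>
    simp only [Finset.sum_range_succ, ← ih, pullCount_succ, mul_add, Finset.sum_add_distrib]
    simp

theorem lt_pullCount_iff (a : Fin K) (i T : ℕ) :
    i < π.pullCount s R a T ↔ ∃ t < T, π.arm s R t = a ∧ π.pullCount s R a t = i := by
  induction T with
  | zero => simp [pullCount]
  | succ T ih =>
    rw [pullCount_succ]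
    constructor
    · intro h
      rcases lt_or_ge i (π.pullCount s R a T) with h1 | h1
      · obtain ⟨t, ht, h2⟩ := ih.mp h1
        exact ⟨t, ht.trans T.lt_succ_self, h2⟩
      · split_ifs at h with h2
        · exact ⟨T, T.lt_succ_self, h2, by omega⟩
        · omega
    · rintro ⟨t, ht, h1, h2⟩
      rcases Nat.lt_succ_iff_lt_or_eq.mp ht with h3 | rfl
      · have := ih.mpr ⟨t, h3, h1, h2⟩
        omega
      · rw [if_pos h1]
        omega

/-- The `(i + 1)`-th pull of arm `a` takes place and is within the budget. -/
def Plays (c : Fin K → ℕ) (B : ℕ) (a : Fin K) (i : ℕ) : Prop :=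
  ∃ t, ∑ j ∈ Finset.range (t + 1), c (π.arm s R j) ≤ B ∧ π.arm s R t = a ∧
    π.pullCount s R a t = i

theorem lt_stopTime_sub_one_iff {c : Fin K → ℕ} (hc : ∀ a, 0 < c a) (B : ℕ)
    (t : ℕ) : t < π.stopTime c B s R - 1 ↔
    ∑ j ∈ Finset.range (t + 1), c (π.arm s R j) ≤ B := by
  have hne : {t : ℕ | B < ∑ i ∈ Finset.range t, c (π.arm s R i)}.Nonempty := by
    refine ⟨B + 1, ?_⟩
    have : ∑ i ∈ Finset.range (B + 1), 1 ≤ ∑ i ∈ Finset.range (B + 1), c (π.arm s R i) :=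
      Finset.sum_le_sum fun i _ => hc _
    simpa using this
  rw [show t < π.stopTime c B s R - 1 ↔ t + 1 < π.stopTime c B s R by omega]
  constructor
  · intro h
    exact not_lt.mp (Nat.notMem_of_lt_sInf
      (s := {t : ℕ | B < ∑ i ∈ Finset.range t, c (π.arm s R i)}) h)
  · intro h
    by_contra hlt
    have h1 : B < ∑ i ∈ Finset.range (π.stopTime c B s R), c (π.arm s R i) := Nat.sInf_mem hne
    have h2 := Finset.sum_le_sum_of_subset (f := fun i => c (π.arm s R i))
      (Finset.range_subset_range.mpr (not_lt.mp hlt))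
    omega

theorem lt_pullCount_stopTime_iff {c : Fin K → ℕ} (hc : ∀ a, 0 < c a) (B : ℕ)
    (a : Fin K) (i : ℕ) :
    i < π.pullCount s R a (π.stopTime c B s R - 1) ↔ π.Plays s R c B a i := by
  simp only [lt_pullCount_iff, lt_stopTime_sub_one_iff π s R hc, Plays]

/-- The numbers of pulls within the budget are an allocation that respects the budget. -/
theorem sum_cost_mul_pullCount_stopTime_le {c : Fin K → ℕ} (hc : ∀ a, 0 < c a) (B : ℕ) :
    ∑ a, c a * π.pullCount s R a (π.stopTime c B s R - 1) ≤ B := by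
  rw [sum_cost_mul_pullCount]
  rcases h : π.stopTime c B s R - 1 with _ | t
  · simp
  · exact (lt_stopTime_sub_one_iff π s R hc B t).mp (by omega)

open Classical in
theorem sum_pullCount_stopTime {c : Fin K → ℕ} (hc : ∀ a, 0 < c a) (B : ℕ)
    (x : Fin K → ℕ → ℝ) :
    ∑ a, ∑ i ∈ Finset.range (π.pullCount s R a (π.stopTime c B s R - 1)), x a i
      = ∑ a, ∑ i ∈ Finset.range B, if π.Plays s R c B a i then x a i else 0 := by
  refine Finset.sum_congr rfl fun a _ => ?_
  have hle : π.pullCount s R a (π.stopTime c B s R - 1) ≤ B :=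
    (Nat.le_mul_of_pos_left _ (hc a)).trans <|
      (Finset.single_le_sum (f := fun a => c a * π.pullCount s R a (π.stopTime c B s R - 1))
        (fun _ _ => Nat.zero_le _) (Finset.mem_univ a)).trans
      (sum_cost_mul_pullCount_stopTime_le π s R hc B)
  rw [← Finset.sum_filter]
  refine Finset.sum_congr ?_ fun _ _ => rfl
  ext i
  simp only [Finset.mem_range, Finset.mem_filter, ← lt_pullCount_stopTime_iff π s R hc]
  omega

variable {R} {R' : Fin K → ℕ → ℝ} {a : Fin K} {i : ℕ}
  {c : Fin K → ℕ} {B : ℕ}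

/-- As long as arm `a` has been pulled at most `i` times, only its rewards with an index below `i`
have entered the history. -/
theorem history_congr (h : ∀ b j, b ≠ a ∨ j < i → R b j = R' b j) (t : ℕ)
    (ht : π.pullCount s R a t ≤ i) : π.history s R t = π.history s R' t := by
  induction t with
  | zero => rfl
  | succ t ih =>
    have hs := pullCount_succ π s R a t
    have e := ih (by omega)
    have hR : π.history s R (t + 1) = Fin.snoc (α := fun _ => Fin K × ℝ) (π.history s R t)
        (π.arm s R t, R (π.arm s R t) (π.pullCount s R (π.arm s R t) t)) := by
      rw [← card_filter_history, arm_eq_choose]; rfl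
    have hR' : π.history s R' (t + 1) = Fin.snoc (α := fun _ => Fin K × ℝ) (π.history s R' t)
        (π.arm s R' t, R' (π.arm s R' t) (π.pullCount s R' (π.arm s R' t) t)) := by
      rw [← card_filter_history, arm_eq_choose]; rfl
    have ha : π.arm s R' t = π.arm s R t := by rw [arm_eq_choose, arm_eq_choose, e]
    have hp : ∀ b, π.pullCount s R' b t = π.pullCount s R b t := fun b => by
      rw [← card_filter_history, ← card_filter_history, e]
    rw [hR, hR', ha, hp, e]
    congr 2
    refine h _ _ ?_
    by_cases hb : π.arm s R t = a
    · right
      rw [if_pos hb] at hs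
      rw [hb]
      omega
    · exact Or.inl hb

/-- Whether the `(i + 1)`-th pull of arm `a` takes place within the budget does not depend on the
reward of this pull nor on later rewards of arm `a`. -/
theorem Plays.congr (h : ∀ b j, b ≠ a ∨ j < i → R b j = R' b j) (hp : π.Plays s R c B a i) :
    π.Plays s R' c B a i := by
  obtain ⟨t, hB, ha, hi⟩ := hp
  have e := history_congr π s h t hi.le
  have harm : ∀ j ≤ t, π.arm s R' j = π.arm s R j := by
    intro j hj
    rcases hj.lt_or_eq with hj | rfl
    · have h1 := history_apply π s R t ⟨j, hj⟩
      have h2 := history_apply π s R' t ⟨j, hj⟩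
      rw [e, h2] at h1
      exact congrArg Prod.fst h1
    · rw [arm_eq_choose, arm_eq_choose, e]
  refine ⟨t, ?_, (harm t le_rfl).trans ha, ?_⟩
  · rwa [Finset.sum_congr rfl fun j hj => by
      rw [harm j (Nat.lt_succ_iff.mp (Finset.mem_range.mp hj))]]
  · rw [← card_filter_history, ← e, card_filter_history, hi]

/-! ### Measurability of a policy's actions -/

theorem measurable_history (t : ℕ) :
    Measurable fun p : π.Seed × (Fin K → ℕ → ℝ) => π.history p.1 p.2 t := by
  induction t with
  | zero => exact measurable_pi_lambda _ fun i => i.elim0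
  | succ t ih =>
    have hch : Measurable fun p : π.Seed × (Fin K → ℕ → ℝ) =>
        π.choose t p.1 (π.history p.1 p.2 t) :=
      (π.measurable_choose t).comp (measurable_fst.prodMk ih)
    have hpulls : Measurable fun p : π.Seed × (Fin K → ℕ → ℝ) =>
        (Finset.univ.filter fun i : Fin t =>
          (π.history p.1 p.2 t i).1 = π.choose t p.1 (π.history p.1 p.2 t)).card := by
      simp only [Finset.card_filter]
      refine Finset.measurable_sum _ fun i _ => Measurable.ite ?_ measurable_const measurable_const
      exact measurableSet_eq_fun (measurable_fst.comp ((measurable_pi_apply i).comp ih)) hch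
    have heval : Measurable fun p : (Fin K → ℕ → ℝ) × (Fin K × ℕ) => p.1 p.2.1 p.2.2 :=
      measurable_from_prod_countable_left fun y =>
        (measurable_pi_apply y.2).comp (measurable_pi_apply y.1)
    refine measurable_pi_lambda _ fun i => ?_
    refine Fin.lastCases ?_ (fun j => ?_) i
    · have : Measurable fun p : π.Seed × (Fin K → ℕ → ℝ) =>
          (π.choose t p.1 (π.history p.1 p.2 t), p.2 (π.choose t p.1 (π.history p.1 p.2 t))
            (Finset.univ.filter fun i : Fin t =>
              (π.history p.1 p.2 t i).1 = π.choose t p.1 (π.history p.1 p.2 t)).card) :=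
        hch.prodMk (heval.comp (measurable_snd.prodMk (hch.prodMk hpulls)))
      convert this using 2 with p
      exact Fin.snoc_last (α := fun _ => Fin K × ℝ) _ _
    · convert (measurable_pi_apply j).comp ih using 2 with p
      exact Fin.snoc_castSucc (α := fun _ => Fin K × ℝ) _ _ j

theorem measurable_arm (t : ℕ) :
    Measurable fun p : π.Seed × (Fin K → ℕ → ℝ) => π.arm p.1 p.2 t :=
  measurable_fst.comp ((measurable_pi_apply (Fin.last t)).comp (π.measurable_history (t + 1)))

theorem measurable_pullCount (a : Fin K) (t : ℕ) :
    Measurable fun p : π.Seed × (Fin K → ℕ → ℝ) => π.pullCount p.1 p.2 a t := by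
  simp only [pullCount, Finset.card_filter]
  exact Finset.measurable_sum _ fun j _ => Measurable.ite
    (measurableSet_eq_fun (π.measurable_arm j) measurable_const) measurable_const measurable_const

theorem measurableSet_plays (c : Fin K → ℕ) (B : ℕ) (a : Fin K) (i : ℕ) :
    MeasurableSet {p : π.Seed × (Fin K → ℕ → ℝ) | π.Plays p.1 p.2 c B a i} := by
  have : {p : π.Seed × (Fin K → ℕ → ℝ) | π.Plays p.1 p.2 c B a i}
      = ⋃ t, ({p | ∑ j ∈ Finset.range (t + 1), c (π.arm p.1 p.2 j) ≤ B}
        ∩ ({p | π.arm p.1 p.2 t = a} ∩ {p | π.pullCount p.1 p.2 a t = i})) := by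
    ext p
    simp [Plays]
  rw [this]
  refine MeasurableSet.iUnion fun t => MeasurableSet.inter ?_ (MeasurableSet.inter ?_ ?_)
  · exact measurableSet_le (Finset.measurable_sum _ fun j _ =>
      (measurable_of_finite c).comp (π.measurable_arm j)) measurable_const
  · exact measurableSet_eq_fun (π.measurable_arm t) measurable_const
  · exact measurableSet_eq_fun (π.measurable_pullCount a t) measurable_const

end Policy

/-! ### Perfect information about the parameters against the finite-horizon estimates -/

variable {K : ℕ} (M : Instance.{u, v} K)

theorem ciSup_eq_ciSup_sum_prefix (x : Fin K → ℝ) :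
    (⨆ b, x b) = ⨆ b, ∑ a, ∑ _i ∈ Finset.range (if a = b then 1 else 0), x a := by
  congr 1
  funext b
  rw [Finset.sum_eq_single b (fun a _ h => by simp [h]) (by simp)]
  simp

theorem integrable_payoffBTS [NeZero K] : Integrable M.payoffBTS M.law :=
  (integrable_ciSup fun a => integrable_pi_eval (μ := M.armLaw) a
    ((integrable_mean M a).div_const (M.c a : ℝ))).const_mul _

theorem integrable_payoffFH [NeZero K] : Integrable M.payoffFH M.law :=
  (integrable_ciSup fun a => integrable_pi_eval (μ := M.armLaw) a
    ((integrable_estimate M a _).div_const (M.c a : ℝ))).const_mul _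

theorem WFH_le_WBTS [NeZero K] : M.WFH ≤ M.WBTS := by
  unfold Instance.WFH Instance.WBTS Instance.payoffFH Instance.payoffBTS
  rw [integral_const_mul, integral_const_mul]
  refine mul_le_mul_of_nonneg_left ?_ (Nat.cast_nonneg _)
  refine (integral_congr_ae (Filter.Eventually.of_forall fun ω =>
    ciSup_eq_ciSup_sum_prefix _)).trans_le (LE.le.trans_eq ?_ (integral_congr_ae
      (Filter.Eventually.of_forall fun ω => (ciSup_eq_ciSup_sum_prefix _).symm)))
  refine integral_ciSup_sum_prefix_le (μ := M.armLaw) (N := Fin K)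
    (fun b a => if a = b then 1 else 0)
    (w := fun a _ o => M.estimate a (M.B / M.c a - 1) (M.firstRewards a _ o) / M.c a)
    (w' := fun a _ o => M.mean a o.1 / M.c a)
    (fun a _ => (integrable_estimate M a _).div_const _)
    (fun a _ => (integrable_mean M a).div_const _) fun a C => ?_
  refine integral_bestPrefix_condExp_le ((rewardFiltration M a).le (M.B / M.c a - 1)) C
    (fun b => by split_ifs <;> simp) ((measurable_estimate_firstRewards M a _).div_const _)
    ((integrable_estimate M a _).div_const _) ((integrable_mean M a).div_const _) ?_
  have h := condExp_smul (μ := M.armLaw a) (M.c a : ℝ)⁻¹ (fun o : M.ArmOutcome a => M.mean a o.1)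
    (rewardFiltration M a (M.B / M.c a - 1))
  have e : (fun o : M.ArmOutcome a => M.mean a o.1 / M.c a)
      = (M.c a : ℝ)⁻¹ • fun o : M.ArmOutcome a => M.mean a o.1 := by
    funext o
    simp [div_eq_inv_mul]
  rw [e]
  filter_upwards [h, estimate_ae_eq_condExp M a (M.B / M.c a - 1)] with o h1 h2
  rw [h1, Pi.smul_apply, ← h2, smul_eq_mul, div_eq_inv_mul]

/-! ### Finite-horizon estimates against estimates that are revealed step by step -/

/-- Integer allocations of pulls that respect the budget. -/
abbrev Allocation : Type := {n : Fin K → ℕ // ∑ a, M.c a * n a ≤ M.B}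

variable {M} in
theorem Allocation.cost_mul_le (n : Allocation M) (a : Fin K) : M.c a * n.1 a ≤ M.B :=
  (Finset.single_le_sum (f := fun a => M.c a * n.1 a) (fun _ _ => Nat.zero_le _)
    (Finset.mem_univ a)).trans n.2

instance : Nonempty (Allocation M) := ⟨⟨0, by simp⟩⟩

instance : Finite (Allocation M) :=
  Finite.of_injective
    (fun (n : Allocation M) (a : Fin K) => (⟨n.1 a, Nat.lt_succ_of_le
      ((Nat.le_mul_of_pos_left _ (M.c_pos a)).trans (n.cost_mul_le a))⟩ : Fin (M.B + 1)))
    fun _ _ h => Subtype.ext (funext fun a => congrArg Fin.val (congrFun h a))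

theorem integrable_payoffVZero : Integrable M.payoffVZero M.law :=
  integrable_ciSup_sum_prefix (μ := M.armLaw) (N := Allocation M) (fun n a => n.1 a)
    (w := fun a i o => M.estimate a i (M.firstRewards a i o)) fun a i => integrable_estimate M a i

theorem muHat_nonneg : ∀ᵐ ω ∂M.law, ∀ a n, 0 ≤ M.muHat a n ω := by
  rw [ae_all_iff]
  intro a
  rw [ae_all_iff]
  intro n
  exact (measurePreserving_eval M.armLaw a).quasiMeasurePreserving.ae (estimate_nonneg M a n)

/-- For nonnegative values per pull, an allocation is worth no more than spending the whole budget
at the best ratio of value and cost. -/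
theorem sum_mul_le_budget_mul_ciSup (n : Allocation M) {z : Fin K → ℝ} (hz : ∀ a, 0 ≤ z a) :
    ∑ a, (n.1 a : ℝ) * z a ≤ M.B * ⨆ a, z a / M.c a := by
  have hc : ∀ a, (0 : ℝ) < M.c a := fun a => Nat.cast_pos.mpr (M.c_pos a)
  have hS : 0 ≤ ⨆ a, z a / M.c a := Real.iSup_nonneg fun a => div_nonneg (hz a) (hc a).le
  calc ∑ a, (n.1 a : ℝ) * z a ≤ ∑ a, (M.c a * n.1 a : ℝ) * ⨆ a, z a / M.c a := by
        refine Finset.sum_le_sum fun a _ => ?_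
        have h : z a / M.c a ≤ ⨆ a, z a / M.c a :=
          le_ciSup (f := fun a => z a / M.c a) (Set.finite_range _).bddAbove a
        rw [div_le_iff₀ (hc a)] at h
        calc (n.1 a : ℝ) * z a ≤ n.1 a * ((⨆ a, z a / M.c a) * M.c a) := by gcongr
          _ = _ := by ring
    _ = ((∑ a, M.c a * n.1 a : ℕ) : ℝ) * ⨆ a, z a / M.c a := by
        rw [← Finset.sum_mul]
        push_cast
        rfl
    _ ≤ M.B * ⨆ a, z a / M.c a := by
        gcongr
        exact_mod_cast n.2

theorem WVZero_le_WFH [NeZero K] : M.WVZero ≤ M.WFH := by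
  have h : M.WVZero ≤ ∫ ω, (⨆ n : Allocation M,
      ∑ a, ∑ _i ∈ Finset.range (n.1 a), M.muHat a (M.B / M.c a - 1) ω) ∂M.law := by
    refine integral_ciSup_sum_prefix_le (μ := M.armLaw) (N := Allocation M) (fun n a => n.1 a)
      (w := fun a i o => M.estimate a i (M.firstRewards a i o))
      (w' := fun a _ o => M.estimate a (M.B / M.c a - 1) (M.firstRewards a _ o))
      (fun a i => integrable_estimate M a i) (fun a _ => integrable_estimate M a _) fun a C => ?_
    refine integral_bestPrefix_martingale_le (martingale_estimate M a) C fun n => ?_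
    have : n.1 a ≤ M.B / M.c a :=
      (Nat.le_div_iff_mul_le (M.c_pos a)).mpr ((mul_comm _ _).trans_le (n.cost_mul_le a))
    omega
  refine h.trans (integral_mono_ae ?_ (integrable_payoffFH M) ?_)
  · exact integrable_ciSup_sum_prefix (μ := M.armLaw) (N := Allocation M) (fun n a => n.1 a)
      (w := fun a _ o => M.estimate a (M.B / M.c a - 1) (M.firstRewards a _ o))
      fun a _ => integrable_estimate M a _
  · filter_upwards [muHat_nonneg M] with ω hω
    refine ciSup_le fun n => ?_
    simp only [Finset.sum_const, Finset.card_range, nsmul_eq_mul]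
    exact sum_mul_le_budget_mul_ciSup M n fun a => hω a _

/-! ### Estimates that are revealed step by step against admissible policies -/

namespace Policy

variable (π : Policy K)

/-- The event that the `(i + 1)`-th pull of arm `a` takes place and is within the budget. -/
def playsEvent (a : Fin K) (i : ℕ) : Set (π.Seed × M.Outcome) :=
  {p | π.Plays p.1 (fun a => (p.2 a).2) M.c M.B a i}

theorem measurableSet_playsEvent (a : Fin K) (i : ℕ) : MeasurableSet (π.playsEvent M a i) :=
  (measurable_fst.prodMk (measurable_pi_lambda _ fun a =>
    measurable_snd.comp ((measurable_pi_apply a).comp measurable_snd)))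
    (π.measurableSet_plays M.c M.B a i)

open Classical in
theorem indicator_playsEvent (a : Fin K) (i : ℕ) (f : π.Seed × M.Outcome → ℝ)
    (p : π.Seed × M.Outcome) : (π.playsEvent M a i).indicator f p
      = if π.Plays p.1 (fun a => (p.2 a).2) M.c M.B a i then f p else 0 :=
  Set.indicator_apply _ _ _

theorem totalReward_eq (p : π.Seed × M.Outcome) : π.totalReward M p
    = ∑ a, ∑ i ∈ Finset.range M.B, (π.playsEvent M a i).indicator (fun p => (p.2 a).2 i) p := by
  unfold totalReward
  rw [sum_gain, sum_pullCount_stopTime π _ _ M.c_pos]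
  simp only [indicator_playsEvent]

theorem sum_indicator_muHat_le_payoffVZero (p : π.Seed × M.Outcome) :
    ∑ a, ∑ i ∈ Finset.range M.B, (π.playsEvent M a i).indicator (fun p => M.muHat a i p.2) p
      ≤ M.payoffVZero p.2 := by
  have h := sum_pullCount_stopTime π p.1 (fun a => (p.2 a).2) M.c_pos M.B
    fun a i => M.muHat a i p.2
  simp only [indicator_playsEvent]
  rw [← h]
  exact le_ciSup (f := fun n : Allocation M =>
    ∑ a, ∑ i ∈ Finset.range (n.1 a), M.muHat a i p.2) (Set.finite_range _).bddAbove
    ⟨_, sum_cost_mul_pullCount_stopTime_le π p.1 _ M.c_pos M.B⟩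

theorem integrable_totalReward : Integrable (π.totalReward M) (π.seedLaw.prod M.law) := by
  refine Integrable.congr ?_ (Filter.Eventually.of_forall fun p => (totalReward_eq M π p).symm)
  refine integrable_finsetSum _ fun a _ => integrable_finsetSum _ fun i _ =>
    Integrable.indicator ?_ (π.measurableSet_playsEvent M a i)
  exact (integrable_pi_eval (μ := M.armLaw) a (integrable_reward_apply M a i)).comp_snd _

/-- Given the seed and the outcomes of the other arms, it is decided by the first `i` rewards of an
arm whether its `(i + 1)`-th pull takes place. -/
theorem measurableSet_playsEvent_update (s : π.Seed) (ω : M.Outcome) (a : Fin K) (i : ℕ) :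
    MeasurableSet[rewardFiltration M a i]
      {o | (s, Function.update ω a o) ∈ π.playsEvent M a i} := by
  -- The rewards of arm `a` from index `i` on are irrelevant and set to `0`.
  let R : (Fin i → ℝ) → Fin K → ℕ → ℝ := fun r =>
    Function.update (fun b => (ω b).2) a fun j => if h : j < i then r ⟨j, h⟩ else 0
  have hR : Measurable R := by
    refine measurable_pi_lambda _ fun b => measurable_pi_lambda _ fun j => ?_
    by_cases hb : b = a
    · subst hb
      by_cases hj : j < i
      · simpa [R, hj] using measurable_pi_apply (⟨j, hj⟩ : Fin i)
      · simp [R, hj]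
    · simp [R, hb]
  refine ⟨{r | π.Plays s (R r) M.c M.B a i},
    (measurable_const.prodMk hR) (π.measurableSet_plays M.c M.B a i), ?_⟩
  ext o
  have h : ∀ b j, b ≠ a ∨ j < i → R (M.firstRewards a i o) b j
      = (Function.update ω a o b).2 j := by
    intro b j hbj
    by_cases hb : b = a
    · subst hb
      have hj : j < i := hbj.resolve_left (fun h => h rfl)
      simp [R, hj, Instance.firstRewards]
    · simp [R, hb]
  exact ⟨fun hp => hp.congr π s h, fun hp => hp.congr π s fun b j hbj => (h b j hbj).symm⟩

theorem measurableSet_playsEvent_section (s : π.Seed) (a : Fin K) (i : ℕ) :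
    MeasurableSet {ω : M.Outcome | (s, ω) ∈ π.playsEvent M a i} :=
  measurable_prodMk_left (π.measurableSet_playsEvent M a i)

/-- A pull contributes on average what its arm is estimated to be worth before the pull. -/
theorem setIntegral_playsEvent (s : π.Seed) (a : Fin K) (i : ℕ) :
    ∫ ω, {ω | (s, ω) ∈ π.playsEvent M a i}.indicator (fun ω : M.Outcome => (ω a).2 i) ω ∂M.law
      = ∫ ω, {ω | (s, ω) ∈ π.playsEvent M a i}.indicator (M.muHat a i) ω ∂M.law := by
  have hm := π.measurableSet_playsEvent_section M s a i
  have hi1 := (integrable_pi_eval (μ := M.armLaw) a (integrable_reward_apply M a i)).indicator hm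
  have hi2 := (integrable_pi_eval (μ := M.armLaw) a (integrable_estimate M a i)).indicator hm
  refine (integral_pi_eq_integral_update a hi1).trans
    (Eq.trans ?_ (integral_pi_eq_integral_update a hi2).symm)
  congr 1
  funext ω
  have hA := π.measurableSet_playsEvent_update M s ω a i
  have e := setIntegral_reward_eq_estimate M a i hA
  rw [← integral_indicator ((rewardFiltration M a).le i _ hA),
    ← integral_indicator ((rewardFiltration M a).le i _ hA)] at e
  convert e using 3 with o o
  · simp [Set.indicator]
  · simp [Set.indicator]

theorem value_le_WVZero : π.value M ≤ M.WVZero := by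
  have hs : ∀ s, ∫ ω, π.totalReward M (s, ω) ∂M.law ≤ M.WVZero := by
    intro s
    have hm := fun a i => π.measurableSet_playsEvent_section M s a i
    have hi1 : ∀ a i, Integrable ({ω | (s, ω) ∈ π.playsEvent M a i}.indicator
        fun ω : M.Outcome => (ω a).2 i) M.law := fun a i =>
      (integrable_pi_eval (μ := M.armLaw) a (integrable_reward_apply M a i)).indicator (hm a i)
    have hi2 : ∀ a i, Integrable ({ω | (s, ω) ∈ π.playsEvent M a i}.indicator
        (M.muHat a i)) M.law := fun a i =>
      (integrable_pi_eval (μ := M.armLaw) a (integrable_estimate M a i)).indicator (hm a i)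
    calc ∫ ω, π.totalReward M (s, ω) ∂M.law
        = ∫ ω, ∑ a, ∑ i ∈ Finset.range M.B, {ω | (s, ω) ∈ π.playsEvent M a i}.indicator
            (fun ω : M.Outcome => (ω a).2 i) ω ∂M.law := by
          simp only [totalReward_eq]
          rfl
      _ = ∑ a, ∑ i ∈ Finset.range M.B, ∫ ω, {ω | (s, ω) ∈ π.playsEvent M a i}.indicator
            (fun ω : M.Outcome => (ω a).2 i) ω ∂M.law := by
          rw [integral_finsetSum _ fun a _ => integrable_finsetSum _ fun i _ => hi1 a i]
          exact Finset.sum_congr rfl fun a _ => integral_finsetSum _ fun i _ => hi1 a i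
      _ = ∑ a, ∑ i ∈ Finset.range M.B, ∫ ω, {ω | (s, ω) ∈ π.playsEvent M a i}.indicator
            (M.muHat a i) ω ∂M.law := by
          simp only [setIntegral_playsEvent]
      _ = ∫ ω, ∑ a, ∑ i ∈ Finset.range M.B, {ω | (s, ω) ∈ π.playsEvent M a i}.indicator
            (M.muHat a i) ω ∂M.law := by
          rw [integral_finsetSum _ fun a _ => integrable_finsetSum _ fun i _ => hi2 a i]
          exact (Finset.sum_congr rfl fun a _ => integral_finsetSum _ fun i _ => hi2 a i).symm
      _ ≤ M.WVZero := by
          refine integral_mono (integrable_finsetSum _ fun a _ =>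
            integrable_finsetSum _ fun i _ => hi2 a i) (integrable_payoffVZero M) fun ω => ?_
          exact π.sum_indicator_muHat_le_payoffVZero M (s, ω)
  unfold value
  rw [integral_prod _ (π.integrable_totalReward M)]
  refine (integral_mono (π.integrable_totalReward M).integral_prod_left
    (integrable_const M.WVZero) hs).trans ?_
  simp

end Policy

instance [NeZero K] : Nonempty (Policy K) :=
  ⟨{ Seed := Unit
     seedLaw := Measure.dirac ()
     choose := fun _ _ _ => 0
     measurable_choose := fun _ => measurable_const }⟩

end BudgetedMAB

theorem theorem1 {K : ℕ} (hK : 0 < K) (M : BudgetedMAB.Instance.{u, v} K) :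
    (MeasureTheory.Integrable M.payoffBTS M.law ∧
      MeasureTheory.Integrable M.payoffFH M.law ∧
      MeasureTheory.Integrable M.payoffVZero M.law ∧
      (∀ π : BudgetedMAB.Policy K,
        MeasureTheory.Integrable (π.totalReward M) (π.seedLaw.prod M.law)) ∧
      BddAbove (Set.range fun π : BudgetedMAB.Policy K => π.value M)) ∧
    M.WBTS ≥ M.WFH ∧ M.WFH ≥ M.WVZero ∧ M.WVZero ≥ M.optValue := by
  have : NeZero K := ⟨hK.ne'⟩
  exact ⟨⟨BudgetedMAB.integrable_payoffBTS M, BudgetedMAB.integrable_payoffFH M,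
    BudgetedMAB.integrable_payoffVZero M, fun π => π.integrable_totalReward M,
    ⟨M.WVZero, Set.forall_mem_range.mpr fun π => π.value_le_WVZero M⟩⟩,
    BudgetedMAB.WFH_le_WBTS M, BudgetedMAB.WVZero_le_WFH M, ciSup_le fun π => π.value_le_WVZero M⟩
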